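/- An instance of $1|r_j,\mathrm{pmtn}|\sum w_jC_j$ consists of $n$ jobs with processing times $p_j>0$, weights $w_j>0$ and release dates $r_j\ge 0$. A (fractional, preemptive) schedule assigns to each job $j$ a measurable rate function $y_j$ with values in $[0,1]$ such that $\sum_j y_j(t)\le 1$ for all $t$, $y_j(t)=0$ if $t<r_j$ or $t>C_j$, and every job is completed; here $Y_j(t)=\int_0^t y_j(s)\,ds$ is the elapsed time of $j$, and its completion time $C_j$ is the smallest $t\ge0$ with $Y_j(t)\ge p_j$. The cost of a schedule is $\sum_j w_jC_j$, and $\mathrm{OPT}(I)$ is the infimum of the costs of all schedules for the instance $I$. A strategy assigns to every instance a schedule; on a class of instances it is $c$-competitive if its cost is at most $c\cdot\mathrm{OPT}(I)$ for every instance $I$ of the class. A strategy is online and non-clairvoyant if its decisions up to any time $t$ depend only on the release dates and weights of the jobs released up to time $t$ and on the processing times of the jobs completed up to time $t$. The Weighted Shortest Elapsed Time First (WSETF) rule is defined as follows. Let $J(t)$ be the set of jobs that are released and unfinished at time $t$, and let $A(t)\subseteq J(t)$ be the set of those $j\in J(t)$ for which $Y_j(t)/w_j$ is minimum. Then $y_j(t)=w_j/\sum_{k\in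 A(t)}w_k$ if $j\in A(t)$, and $y_j(t)=0$ otherwise. **Theorem.** There is exactly one strategy that follows the WSETF rule at every time on every instance. This strategy is online and non-clairvoyant, and it is $2$-competitive for $1|r_j,\mathrm{pmtn}|\sum w_jC_j$. This matches the lower bound of $2$ for the unit-weight case: if an online non-clairvoyant (deterministic, preemptive) strategy is $c$-competitive on the instances with unit weights $w_j=1$ and trivial release dates $r_j=0$, then $c\ge 2$. -/

import Mathlib

open scoped BigOperators

noncomputable section

namespace Scheduling

/-- A single-machine instance with `n` jobs: processing times `p`, weights `w`, and
release dates `r`. -/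
structure Instance (n : ℕ) where
  p : Fin n → ℝ
  w : Fin n → ℝ
  r : Fin n → ℝ
  p_pos : ∀ j, 0 < p j
  w_pos : ∀ j, 0 < w j
  r_nonneg : ∀ j, 0 ≤ r j

variable {n : ℕ}

/-- The elapsed processing time `Y_j(t) = ∫_0^t y_j(s) ds` of job `j` at time `t`, if the
job `k` is processed at rate `y k s` at each time `s`. -/
def elapsed (y : Fin n → ℝ → ℝ) (j : Fin n) (t : ℝ) : ℝ :=
  ∫ s in (0 : ℝ)..t, y j s

/-- The completion time of job `j`: the smallest `t ≥ 0` with `Y_j(t) ≥ p_j`. -/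
def completionTime (I : Instance n) (y : Fin n → ℝ → ℝ) (j : Fin n) : ℝ :=
  sInf {t : ℝ | 0 ≤ t ∧ I.p j ≤ elapsed y j t}

/-- A feasible fractional preemptive schedule on one machine in which every job is completed.
The first two inequalities together say that all the rates lie in `[0, 1]`; as release dates
are nonnegative, all rates vanish at negative times. -/
@[ext]
structure Schedule (I : Instance n) where
  /-- `rate j t` is the rate at which job `j` is processed at time `t`. -/
  rate : Fin n → ℝ → ℝ
  measurable_rate : ∀ j, Measurable (rate j)
  rate_nonneg : ∀ j t, 0 ≤ rate j t
  sum_rate_le_one : ∀ t, ∑ j, rate j t ≤ 1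
  rate_before_release : ∀ j t, t < I.r j → rate j t = 0
  rate_after_completion : ∀ j t, completionTime I rate j < t → rate j t = 0
  completes : ∀ j, ∃ t : ℝ, 0 ≤ t ∧ I.p j ≤ elapsed rate j t

/-- The weighted sum of completion times `∑ w_j C_j` of a schedule. -/
def Schedule.cost {I : Instance n} (S : Schedule I) : ℝ :=
  ∑ j, I.w j * completionTime I S.rate j

/-- The (clairvoyant, offline, preemptive) optimum: the infimum of `∑ w_j C_j` over all
feasible schedules. -/
def opt (I : Instance n) : ℝ :=
  ⨅ S : Schedule I, S.cost

open Classical in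
/-- The set `J(t)` of jobs that are released and unfinished at time `t`. -/
def pending (I : Instance n) (y : Fin n → ℝ → ℝ) (t : ℝ) : Finset (Fin n) :=
  Finset.univ.filter fun j => I.r j ≤ t ∧ elapsed y j t < I.p j

open Classical in
/-- The set `A(t)` of jobs in `J(t)` with minimum ratio of elapsed time over weight. -/
def active (I : Instance n) (y : Fin n → ℝ → ℝ) (t : ℝ) : Finset (Fin n) :=
  (pending I y t).filter fun j =>
    ∀ k ∈ pending I y t, elapsed y j t / I.w j ≤ elapsed y k t / I.w k

open Classical in
/-- The rate prescribed by Weighted Shortest Elapsed Time First to job `j` at time `t`, given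
the processing so far: the machine is shared among `A(t)` proportionally to the weights. -/
def wsetfRate (I : Instance n) (y : Fin n → ℝ → ℝ) (j : Fin n) (t : ℝ) : ℝ :=
  if j ∈ active I y t then I.w j / ∑ k ∈ active I y t, I.w k else 0

/-- The schedule follows the WSETF rule at every time. -/
def Schedule.IsWSETF {I : Instance n} (S : Schedule I) : Prop :=
  ∀ j t, S.rate j t = wsetfRate I S.rate j t

/-- A deterministic preemptive scheduling strategy assigns to each instance a schedule. No
restriction on the information it uses is imposed here. -/
abbrev Strategy : Type :=
  ∀ n : ℕ, ∀ I : Instance n, Schedule I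

namespace Strategy

/-- The strategy that schedules every instance by the WSETF rule. -/
def IsWSETF (A : Strategy) : Prop :=
  ∀ (n : ℕ) (I : Instance n), (A n I).IsWSETF

/-- `A` is `c`-competitive on the instances satisfying `P`. -/
def IsCompetitiveOn (A : Strategy) (P : ∀ n : ℕ, Instance n → Prop) (c : ℝ) : Prop :=
  ∀ (n : ℕ) (I : Instance n), P n I → (A n I).cost ≤ c * opt I

/-- `A` is `c`-competitive. -/
def IsCompetitive (A : Strategy) (c : ℝ) : Prop :=
  A.IsCompetitiveOn (fun _ _ => True) c

/-- `A` is online and non-clairvoyant. A job is unknown before its release date, at which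
its weight becomes known, and its processing time becomes known upon its completion. So let
`I` and `I'` be instances, where `I'` may have further jobs, and let `t` be a time such that
* each job of `I` either is released after `t` in both instances, or has in both of them the
  same release date and weight, and also the same processing time unless the job has, in the
  run of `A` on `I`, by time `t` received less than either processing time;
* each further job of `I'` is released after `t`.
Then `A` cannot tell the instances apart until time `t`, so its decisions agree up to `t`. -/
def IsOnlineNonClairvoyant (A : Strategy) : Prop :=
  ∀ (n m : ℕ) (h : n ≤ m) (I : Instance n) (I' : Instance m) (t : ℝ),
    (∀ j : Fin n,
      (t < I.r j ∧ t < I'.r (Fin.castLE h j)) ∨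
      (I.r j = I'.r (Fin.castLE h j) ∧ I.w j = I'.w (Fin.castLE h j) ∧
        (I.p j = I'.p (Fin.castLE h j) ∨
          (elapsed (A n I).rate j t < I.p j ∧
            elapsed (A n I).rate j t < I'.p (Fin.castLE h j))))) →
    (∀ i : Fin m, n ≤ (i : ℕ) → t < I'.r i) →
    ∀ (j : Fin n) (s : ℝ), s ≤ t → (A n I).rate j s = (A m I').rate (Fin.castLE h j) s

end Strategy

/-- Unit weights and trivial release dates. -/
def Instance.IsUnitTrivial (I : Instance n) : Prop :=
  (∀ j, I.w j = 1) ∧ ∀ j, I.r j = 0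

end Scheduling

end

namespace Scheduling

open MeasureTheory Set Filter Topology

variable {n : ℕ}

/-! Upper bound. Compare the WSETF run, with elapsed times Y_k, to any schedule, with elapsed times
X_k. Fix j and put θ = p_j/w_j. Between its release and completion, j is pending below level θ, so
WSETF works only on jobs below θ and Σ_k min(Y_k, w_kθ) grows at rate 1. Hence C_j ≤ r_j + q_j − Σ_k
min(Y_k(r_j), w_kθ), where q_j = Σ_k min(p_k, w_kθ) (`Schedule.IsWSETF.completionTime_le`). The
subtracted sum is at least a_j = Σ_k X_k(r_j)·min(1, w_kθ/p_k) (`Schedule.IsWSETF.sum_mul_min_le`).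
On the other side, w_j q_j = Σ_k c_jk p_j p_k with the symmetric matrix c_jk = min(w_j/p_j,
w_k/p_k), and writing p_j p_k by parts along X gives Σ w_j q_j ≤ 2 Σ w_j (C_j^X − r_j + a_j)
(`Schedule.le_two_mul_cost`). Since a_j ≤ r_j, the two estimates combine to the factor 2.

Existence and uniqueness. The rule is discontinuous in the elapsed times, but right after any time T
every run that obeys it has the constant rates prescribed at T. Continuous induction gives
uniqueness, and a supremum argument gives existence. Non-clairvoyance follows from uniqueness: the
run on one instance also obeys the rule on an indistinguishable one.

Lower bound. An adversary lets n jobs run until time 1 and then makes each need only ε more than it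
received. Nothing finishes before time 1, while the optimum is about (n+1)/2. -/

/-- A family of measurable processing rates with values in `[0, 1]`. -/
structure IsRate (y : Fin n → ℝ → ℝ) : Prop where
  measurable : ∀ j, Measurable (y j)
  nonneg : ∀ j t, 0 ≤ y j t
  le_one : ∀ j t, y j t ≤ 1

/-! ### Calculus of elapsed times -/

namespace IsRate

variable {y : Fin n → ℝ → ℝ}

theorem intervalIntegrable (hy : IsRate y) (j : Fin n) (a b : ℝ) :
    IntervalIntegrable (y j) volume a b := by
  refine (intervalIntegrable_const (c := (1 : ℝ))).mono_fun
    (hy.measurable j).aestronglyMeasurable (Eventually.of_forall fun t => ?_)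
  simpa [abs_of_nonneg (hy.nonneg j t)] using hy.le_one j t

theorem elapsed_sub (hy : IsRate y) (j : Fin n) (a b : ℝ) :
    elapsed y j b - elapsed y j a = ∫ s in a..b, y j s :=
  intervalIntegral.integral_interval_sub_left (hy.intervalIntegrable j _ _)
    (hy.intervalIntegrable j _ _)

theorem elapsed_mono (hy : IsRate y) (j : Fin n) : Monotone (elapsed y j) := fun a b hab => by
  have := hy.elapsed_sub j a b
  have := intervalIntegral.integral_nonneg (μ := volume) hab fun u _ => hy.nonneg j u
  linarith

theorem continuous_elapsed (hy : IsRate y) (j : Fin n) : Continuous (elapsed y j) :=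
  intervalIntegral.continuous_primitive (fun a b => hy.intervalIntegrable j a b) 0

theorem elapsed_eq_of_rate_eq_zero (hy : IsRate y) {j : Fin n} {a b : ℝ} (hab : a ≤ b)
    (h : ∀ u ∈ Ioo a b, y j u = 0) : elapsed y j b = elapsed y j a := by
  have h1 := hy.elapsed_sub j a b
  rw [intervalIntegral.integral_congr_Ioo_of_le hab (g := fun _ => (0 : ℝ)) h] at h1
  simpa [sub_eq_zero] using h1

theorem elapsed_sub_eq_mul (hy : IsRate y) {j : Fin n} {a b c : ℝ} (hab : a ≤ b)
    (h : ∀ u ∈ Ioo a b, y j u = c) : elapsed y j b = elapsed y j a + (b - a) * c := by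
  have h1 := hy.elapsed_sub j a b
  rw [intervalIntegral.integral_congr_Ioo_of_le hab (g := fun _ => c) h] at h1
  simp only [intervalIntegral.integral_const, smul_eq_mul] at h1
  linarith

theorem sum_elapsed_sub_le (hy : IsRate y) (hs : ∀ t, ∑ j, y j t ≤ 1) {a b : ℝ} (hab : a ≤ b) :
    ∑ j, (elapsed y j b - elapsed y j a) ≤ b - a := by
  simp only [hy.elapsed_sub]
  rw [← intervalIntegral.integral_finsetSum fun j _ => hy.intervalIntegrable j a b]
  calc ∫ s in a..b, ∑ j, y j s ≤ ∫ s in a..b, (1 : ℝ) :=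
        intervalIntegral.integral_mono_on hab
          (by simpa only [Finset.sum_fn] using
            IntervalIntegrable.sum Finset.univ fun j _ => hy.intervalIntegrable j a b)
          intervalIntegrable_const fun u _ => hs u
    _ = b - a := by simp

theorem sum_elapsed_sub_eq (hy : IsRate y) {a b : ℝ} (hab : a ≤ b)
    (hs : ∀ t ∈ Ioo a b, ∑ j, y j t = 1) :
    ∑ j, (elapsed y j b - elapsed y j a) = b - a := by
  simp only [hy.elapsed_sub]
  rw [← intervalIntegral.integral_finsetSum fun j _ => hy.intervalIntegrable j a b,
    intervalIntegral.integral_congr_Ioo_of_le hab (g := fun _ => (1 : ℝ)) hs]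
  simp

/-- If a job is not processed while its elapsed time is at least `c`, then truncating the elapsed
time at `c` does not change its increment. -/
theorem min_elapsed_sub (hy : IsRate y) {j : Fin n} {a b c : ℝ} (hab : a ≤ b)
    (h : ∀ u ∈ Ioo a b, c ≤ elapsed y j u → y j u = 0) :
    min (elapsed y j b) c - min (elapsed y j a) c = elapsed y j b - elapsed y j a := by
  have hm := hy.elapsed_mono j
  rcases le_or_gt (elapsed y j b) c with hb | hb
  · rw [min_eq_left hb, min_eq_left ((hm hab).trans hb)]
  · rcases le_or_gt c (elapsed y j a) with ha | ha
    · rw [hy.elapsed_eq_of_rate_eq_zero hab fun u hu => h u hu (ha.trans (hm hu.1.le))]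
      simp
    -- The elapsed time cannot cross `c`: once it equals `c`, the job is frozen.
    · obtain ⟨u, hu, huc⟩ := intermediate_value_Icc hab (hy.continuous_elapsed j).continuousOn
        ⟨ha.le, hb.le⟩
      have := hy.elapsed_eq_of_rate_eq_zero hu.2 fun v hv =>
        h v ⟨hu.1.trans_lt hv.1, hv.2⟩ (huc ▸ hm hv.1.le)
      linarith

/-- Integration by parts for elapsed times. -/
theorem integral_rate_mul_elapsed (hy : IsRate y) (j k : Fin n) (T : ℝ) :
    (∫ s in (0 : ℝ)..T, y j s * elapsed y k s) + ∫ s in (0 : ℝ)..T, y k s * elapsed y j s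
      = elapsed y j T * elapsed y k T := by
  -- Rates are merely measurable, so the product rule holds only almost everywhere; absolute
  -- continuity suffices.
  have hac (i : Fin n) : AbsolutelyContinuousOnInterval (elapsed y i) 0 T :=
    (hy.intervalIntegrable i 0 T).absolutelyContinuousOnInterval_intervalIntegral (by simp)
  have hi (i l : Fin n) : IntervalIntegrable (fun s => y i s * elapsed y l s) volume 0 T :=
    (hy.intervalIntegrable i 0 T).mul_continuousOn (hy.continuous_elapsed l).continuousOn
  have h := (hac j).integral_deriv_mul_eq_sub (hac k)
  rw [← intervalIntegral.integral_add (hi j k) (hi k j)]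
  have h0 (i : Fin n) : elapsed y i 0 = 0 := by simp [elapsed]
  rw [h0, h0, zero_mul, sub_zero] at h
  rw [← h]
  refine intervalIntegral.integral_congr_ae ?_
  filter_upwards [(hy.intervalIntegrable j 0 T).ae_hasDerivAt_integral,
    (hy.intervalIntegrable k 0 T).ae_hasDerivAt_integral] with x hj hk hx
  have hx' := uIoc_subset_uIcc hx
  have h1 : deriv (elapsed y j) x = y j x := (hj hx' 0 (by simp)).deriv
  have h2 : deriv (elapsed y k) x = y k x := (hk hx' 0 (by simp)).deriv
  rw [h1, h2]
  ring

end IsRate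

theorem elapsed_zero (y : Fin n → ℝ → ℝ) (j : Fin n) : elapsed y j 0 = 0 := by simp [elapsed]

theorem elapsed_congr {m : ℕ} {y : Fin n → ℝ → ℝ} {y' : Fin m → ℝ → ℝ} {j : Fin n} {j' : Fin m}
    {T t : ℝ} (ht : 0 ≤ t) (htT : t ≤ T) (h : ∀ s < T, y j s = y' j' s) :
    elapsed y j t = elapsed y' j' t :=
  intervalIntegral.integral_congr_Ioo_of_le ht fun s hs => h s (hs.2.trans_le htT)

/-! ### The WSETF rule -/

section Rule

variable (I : Instance n) {y : Fin n → ℝ → ℝ} {t : ℝ} {j k : Fin n}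

theorem mem_pending : j ∈ pending I y t ↔ I.r j ≤ t ∧ elapsed y j t < I.p j := by
  simp [pending]

theorem mem_active : j ∈ active I y t ↔ j ∈ pending I y t ∧
    ∀ k ∈ pending I y t, elapsed y j t / I.w j ≤ elapsed y k t / I.w k := by
  simp [active]

theorem active_nonempty (h : (pending I y t).Nonempty) : (active I y t).Nonempty := by
  obtain ⟨j, hj, hmin⟩ := Finset.exists_min_image (pending I y t) (fun j => elapsed y j t / I.w j) h
  exact ⟨j, (mem_active I).2 ⟨hj, hmin⟩⟩

theorem wsetfRate_eq_zero (h : j ∉ active I y t) : wsetfRate I y j t = 0 := if_neg h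

theorem wsetfRate_of_mem (h : j ∈ active I y t) :
    wsetfRate I y j t = I.w j / ∑ k ∈ active I y t, I.w k := if_pos h

theorem wsetfRate_nonneg : 0 ≤ wsetfRate I y j t := by
  unfold wsetfRate
  split_ifs
  · exact div_nonneg (I.w_pos j).le (Finset.sum_nonneg fun k _ => (I.w_pos k).le)
  · rfl

theorem sum_wsetfRate (h : (pending I y t).Nonempty) : ∑ j, wsetfRate I y j t = 1 := by
  have hpos : 0 < ∑ k ∈ active I y t, I.w k :=
    Finset.sum_pos (fun k _ => I.w_pos k) (active_nonempty I h)
  simp only [wsetfRate, Finset.sum_ite_mem, Finset.univ_inter, ← Finset.sum_div]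
  exact div_self hpos.ne'

theorem sum_wsetfRate_le_one : ∑ j, wsetfRate I y j t ≤ 1 := by
  rcases (pending I y t).eq_empty_or_nonempty with h | h
  · have : active I y t = ∅ := by simp [active, h]
    simp [wsetfRate, this]
  · exact (sum_wsetfRate I h).le

theorem wsetfRate_le_one : wsetfRate I y j t ≤ 1 :=
  (Finset.single_le_sum (f := fun j => wsetfRate I y j t) (fun _ _ => wsetfRate_nonneg I)
    (Finset.mem_univ j)).trans
    (sum_wsetfRate_le_one I)

theorem wsetfRate_of_lt_release (h : t < I.r j) : wsetfRate I y j t = 0 :=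
  wsetfRate_eq_zero I fun hj => h.not_ge ((mem_pending I).1 ((mem_active I).1 hj).1).1

theorem wsetfRate_of_completed (h : I.p j ≤ elapsed y j t) : wsetfRate I y j t = 0 :=
  wsetfRate_eq_zero I fun hj => h.not_gt ((mem_pending I).1 ((mem_active I).1 hj).1).2

/-- A job is not processed while the level of another pending job is lower. -/
theorem wsetfRate_of_level_lt (hj : j ∈ pending I y t)
    (h : elapsed y j t / I.w j < elapsed y k t / I.w k) : wsetfRate I y k t = 0 :=
  wsetfRate_eq_zero I fun hk => h.not_ge (((mem_active I).1 hk).2 j hj)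

/-- The embedding places the jobs of one instance inside a larger one, so that runs on both can be
compared. -/
theorem active_congr {m : ℕ} {I' : Instance m} {y' : Fin m → ℝ → ℝ} (f : Fin n ↪ Fin m)
    (hp : pending I' y' t = (pending I y t).map f)
    (hl : ∀ j ∈ pending I y t, elapsed y' (f j) t / I'.w (f j) = elapsed y j t / I.w j) :
    active I' y' t = (active I y t).map f := by
  ext i
  simp only [mem_active, hp, Finset.mem_map]
  constructor
  · rintro ⟨⟨j, hj, rfl⟩, h⟩
    refine ⟨j, ⟨hj, fun k hk => ?_⟩, rfl⟩
    rw [← hl j hj, ← hl k hk]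
    exact h _ ⟨k, hk, rfl⟩
  · rintro ⟨j, ⟨hj, h⟩, rfl⟩
    refine ⟨⟨j, hj, rfl⟩, ?_⟩
    rintro _ ⟨k, hk, rfl⟩
    rw [hl j hj, hl k hk]
    exact h k hk

/-- The rule sees the past only through the current elapsed times, which makes the run the solution
of an initial value problem. -/
theorem wsetfRate_congr {y' : Fin n → ℝ → ℝ} (h : ∀ k, elapsed y k t = elapsed y' k t) (j : Fin n) :
    wsetfRate I y j t = wsetfRate I y' j t := by
  have hp : pending I y t = pending I y' t := by ext; simp [mem_pending, h]
  have ha : active I y t = active I y' t := by ext; simp [mem_active, hp, h]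
  simp only [wsetfRate, ha]

end Rule

/-- A continuous function that is nonpositive at `a` and positive at `b` is nonpositive for the
last time at some point of `[a, b)`. -/
theorem exists_last_nonpos {f : ℝ → ℝ} (hf : Continuous f) {a b : ℝ} (hab : a ≤ b) (ha : f a ≤ 0)
    (hb : 0 < f b) : ∃ s, a ≤ s ∧ s < b ∧ f s ≤ 0 ∧ ∀ v ∈ Ioc s b, 0 < f v := by
  have hc : IsCompact (Icc a b ∩ {s | f s ≤ 0}) :=
    isCompact_Icc.inter_right (isClosed_le hf continuous_const)
  obtain ⟨s, ⟨hs, hfs⟩, hmax⟩ := hc.exists_isGreatest ⟨a, ⟨le_rfl, hab⟩, ha⟩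
  have hfs' : f s ≤ 0 := hfs
  refine ⟨s, hs.1, lt_of_le_of_ne hs.2 ?_, hfs', fun v hv => ?_⟩
  · rintro rfl
    exact hb.not_ge hfs'
  · by_contra h
    exact hv.1.not_ge (hmax ⟨⟨hs.1.trans hv.1.le, hv.2⟩, not_lt.1 h⟩)

/-! ### The rule just after a given time -/

section Local

variable {I : Instance n} {y : Fin n → ℝ → ℝ}

theorem IsRate.continuous_level (hy : IsRate y) (j : Fin n) :
    Continuous fun t => elapsed y j t / I.w j :=
  (hy.continuous_elapsed j).div_const _

/-- Release and completion are permanent; being unreleased or unfinished is a strict inequality,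
hence persists for a while. -/
theorem IsRate.eventually_pending_eq (hy : IsRate y) (T : ℝ) :
    ∀ᶠ u in 𝓝[>] T, pending I y u = pending I y T := by
  have h (j : Fin n) : ∀ᶠ u in 𝓝[>] T, (j ∈ pending I y u ↔ j ∈ pending I y T) := by
    simp only [mem_pending]
    rcases le_or_gt (I.r j) T with hr | hr
    · rcases lt_or_ge (elapsed y j T) (I.p j) with hp | hp
      · filter_upwards [self_mem_nhdsWithin, mem_nhdsWithin_of_mem_nhds
          ((hy.continuous_elapsed j).continuousAt.eventually_lt_const hp)] with u hu hu'
        exact iff_of_true ⟨hr.trans (le_of_lt hu), hu'⟩ ⟨hr, hp⟩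
      · filter_upwards [self_mem_nhdsWithin] with u hu
        exact iff_of_false (fun h => h.2.not_ge (hp.trans (hy.elapsed_mono j (le_of_lt hu))))
          fun h => h.2.not_ge hp
    · filter_upwards [mem_nhdsWithin_of_mem_nhds (Iio_mem_nhds hr)] with u hu
      exact iff_of_false (fun h => h.1.not_gt hu) fun h => h.1.not_gt hr
  filter_upwards [eventually_all.2 h] with u hu
  exact Finset.ext hu

/-- A pending job outside the active set lies strictly above some pending job, and stays so for a
while by continuity. -/
theorem IsRate.eventually_active_subset (hy : IsRate y) (T : ℝ) :
    ∀ᶠ u in 𝓝[>] T, active I y u ⊆ active I y T := by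
  have h (k : Fin n) : ∀ᶠ u in 𝓝[>] T, k ∈ active I y u → k ∈ active I y T := by
    by_cases hk : k ∈ active I y T
    · exact Eventually.of_forall fun _ _ => hk
    by_cases hkp : k ∈ pending I y T
    · simp only [mem_active, hkp, true_and, not_forall, not_le] at hk
      obtain ⟨j, hj, hjk⟩ := hk
      filter_upwards [hy.eventually_pending_eq T, mem_nhdsWithin_of_mem_nhds
        ((hy.continuous_level j).continuousAt.eventually_lt
          (hy.continuous_level k).continuousAt hjk)] with u hu hu' hku
      exact absurd (((mem_active I).1 hku).2 j (hu ▸ hj)) hu'.not_ge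
    · filter_upwards [hy.eventually_pending_eq T] with u hu hku
      exact absurd (hu ▸ ((mem_active I).1 hku).1) hkp
  filter_upwards [eventually_all.2 h] with u hu
  exact fun k => hu k

theorem wsetfRate_of_active_eq {t T : ℝ} (h : active I y t = active I y T) (j : Fin n) :
    wsetfRate I y j t = wsetfRate I y j T := by
  simp only [wsetfRate, h]

/-- If the active jobs share a common level, no job that was active drops out. -/
theorem active_eq_of_level_eq {t T : ℝ} (hp : pending I y t = pending I y T)
    (hs : active I y t ⊆ active I y T)
    (hl : ∀ j ∈ active I y T, ∀ k ∈ active I y T,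
      elapsed y j t / I.w j ≤ elapsed y k t / I.w k) :
    active I y t = active I y T := by
  refine hs.antisymm fun j hj => ?_
  have hjp : j ∈ pending I y t := hp ▸ ((mem_active I).1 hj).1
  obtain ⟨k, hk⟩ := active_nonempty I ⟨j, hjp⟩
  exact (mem_active I).2 ⟨hjp, fun i hi =>
    (hl j hj k (hs hk)).trans (((mem_active I).1 hk).2 i hi)⟩

theorem level_eq_of_mem_active {T : ℝ} {j k : Fin n} (hj : j ∈ active I y T)
    (hk : k ∈ active I y T) : elapsed y j T / I.w j = elapsed y k T / I.w k :=
  le_antisymm (((mem_active I).1 hj).2 k ((mem_active I).1 hk).1)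
    (((mem_active I).1 hk).2 j ((mem_active I).1 hj).1)

/-- If the jobs are processed at the constant rates that WSETF prescribes at time `T`, then the
rule is obeyed for some time after `T`. -/
theorem IsRate.eventually_wsetfRate_eq (hy : IsRate y) {T : ℝ}
    (h : ∀ u > T, ∀ j, y j u = wsetfRate I y j T) :
    ∀ᶠ u in 𝓝[>] T, ∀ j, wsetfRate I y j u = wsetfRate I y j T := by
  filter_upwards [hy.eventually_pending_eq (I := I) T, hy.eventually_active_subset (I := I) T,
    self_mem_nhdsWithin] with u hp hs hu
  refine wsetfRate_of_active_eq (active_eq_of_level_eq hp hs fun j hj k hk => le_of_eq ?_)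
  have he (i : Fin n) := hy.elapsed_sub_eq_mul (le_of_lt hu) fun v hv => h v hv.1 i
  rw [he j, he k, add_div, add_div, level_eq_of_mem_active hj hk, wsetfRate_of_mem I hj,
    wsetfRate_of_mem I hk]
  have := (I.w_pos j).ne'
  have := (I.w_pos k).ne'
  field_simp

/-- If the rule is obeyed after time `T`, then for some time the jobs are processed at the rates
that it prescribes at `T`. -/
theorem IsRate.eventually_elapsed_eq (hy : IsRate y) {T b : ℝ} (hTb : T < b)
    (h : ∀ j, ∀ u < b, y j u = wsetfRate I y j u) :
    ∀ᶠ u in 𝓝[>] T, ∀ j, elapsed y j u = elapsed y j T + (u - T) * wsetfRate I y j T := by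
  obtain ⟨c, hc, hsub⟩ := (mem_nhdsGT_iff_exists_Ioo_subset' hTb).1
    ((hy.eventually_pending_eq (I := I) T).and (hy.eventually_active_subset (I := I) T))
  have hTc : T < min b c := lt_min hTb hc
  filter_upwards [Ioo_mem_nhdsGT hTc] with u hu j
  refine hy.elapsed_sub_eq_mul hu.1.le fun v hv => ?_
  have hvb : v < min b c := hv.2.trans hu.2
  rw [h j v (hvb.trans_le (min_le_left _ _))]
  have hv' := hsub ⟨hv.1, hvb.trans_le (min_le_right _ _)⟩
  refine wsetfRate_of_active_eq (active_eq_of_level_eq hv'.1 hv'.2 fun i hi k hk => ?_) j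
  -- If the level of `i` exceeded that of `k`, then since the last time `s` when it did not, `i` was
  -- frozen while the level of `k` could only rise.
  by_contra! hlt
  obtain ⟨s, hTs, hsv, hs0, hspos⟩ := exists_last_nonpos
    ((hy.continuous_level i (I := I)).sub (hy.continuous_level k (I := I))) hv.1.le
    (by simp [level_eq_of_mem_active hi hk]) (sub_pos.2 hlt)
  have h1 : elapsed y i v = elapsed y i s := by
    refine hy.elapsed_eq_of_rate_eq_zero hsv.le fun x hx => ?_
    have hxc : x < min b c := hx.2.trans hvb
    have hxT : T < x := hTs.trans_lt hx.1
    rw [h i x (hxc.trans_le (min_le_left _ _))]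
    refine wsetfRate_of_level_lt I (j := k) ?_ (sub_pos.1 (hspos x ⟨hx.1, hx.2.le⟩))
    rw [(hsub ⟨hxT, hxc.trans_le (min_le_right _ _)⟩).1]
    exact ((mem_active I).1 hk).1
  have h2 : elapsed y k s / I.w k ≤ elapsed y k v / I.w k :=
    div_le_div_of_nonneg_right (hy.elapsed_mono k hsv.le) (I.w_pos k).le
  simp only [Pi.sub_apply] at hs0
  rw [h1] at hlt
  linarith

end Local

/-- Rates that obey the WSETF rule before time `T`. -/
structure FollowsWSETF (I : Instance n) (y : Fin n → ℝ → ℝ) (T : ℝ) : Prop extends IsRate y where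
  rule : ∀ j, ∀ s < T, y j s = wsetfRate I y j s

/-! ### Existence and uniqueness of the WSETF run -/

namespace FollowsWSETF

variable {I : Instance n} {y y' : Fin n → ℝ → ℝ} {T : ℝ}

theorem mono (hy : FollowsWSETF I y T) {T' : ℝ} (h : T' ≤ T) : FollowsWSETF I y T' :=
  ⟨hy.toIsRate, fun j s hs => hy.rule j s (hs.trans_le h)⟩

/-- Continuous induction: the set of times of agreement is closed, and from each of its points both
runs continue at the same constant rates. -/
theorem elapsed_unique (hy : FollowsWSETF I y T) (hy' : FollowsWSETF I y' T) {t : ℝ} (ht : 0 ≤ t)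
    (htT : t ≤ T) (j : Fin n) : elapsed y j t = elapsed y' j t := by
  have hclosed : IsClosed {s | ∀ k, elapsed y k s = elapsed y' k s} := by
    simp only [ofPred_forall]
    exact isClosed_iInter fun k => isClosed_eq (hy.continuous_elapsed k) (hy'.continuous_elapsed k)
  refine (hclosed.inter isClosed_Icc).Icc_subset_of_forall_mem_nhdsWithin (a := 0) (b := T)
    (fun k => by simp [elapsed_zero]) (fun x hx => ?_) ⟨ht, htT⟩ j
  filter_upwards [hy.eventually_elapsed_eq hx.2.2 hy.rule,
    hy'.eventually_elapsed_eq hx.2.2 hy'.rule] with u hu hu' k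
  rw [hu, hu', hx.1 k, wsetfRate_congr I hx.1]

theorem rate_unique (hy : FollowsWSETF I y T) (hy' : FollowsWSETF I y' T) (j : Fin n) {s : ℝ}
    (hs : s < T) : y j s = y' j s := by
  rw [hy.rule j s hs, hy'.rule j s hs]
  rcases lt_or_ge s 0 with h | h
  · rw [wsetfRate_of_lt_release I (h.trans_le (I.r_nonneg j)),
      wsetfRate_of_lt_release I (h.trans_le (I.r_nonneg j))]
  · exact wsetfRate_congr I (fun k => hy.elapsed_unique hy' h hs.le k) j

theorem of_rate_eq (hy : FollowsWSETF I y T) (hr : IsRate y') (h : ∀ j, ∀ s < T, y' j s = y j s) :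
    FollowsWSETF I y' T := by
  refine ⟨hr, fun j s hs => ?_⟩
  rw [h j s hs, hy.rule j s hs]
  rcases lt_or_ge s 0 with h0 | h0
  · rw [wsetfRate_of_lt_release I (h0.trans_le (I.r_nonneg j)),
      wsetfRate_of_lt_release I (h0.trans_le (I.r_nonneg j))]
  · exact wsetfRate_congr I (fun k => elapsed_congr h0 hs.le fun s hs => (h k s hs).symm) j

theorem zero (I : Instance n) : FollowsWSETF I (fun _ _ => 0) 0 where
  measurable _ := measurable_const
  nonneg _ _ := le_rfl
  le_one _ _ := zero_le_one
  rule j _ hs := (wsetfRate_of_lt_release I (hs.trans_le (I.r_nonneg j))).symm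

/-- Keep the rates prescribed at `T`: active jobs then rise at equal speed in level, so the
prescription does not change for a while. -/
theorem exists_extend (hy : FollowsWSETF I y T) (hT : 0 ≤ T) :
    ∃ T' > T, ∃ y', FollowsWSETF I y' T' := by
  set y' : Fin n → ℝ → ℝ := fun j s => if s < T then y j s else wsetfRate I y j T with hy'
  have hr : IsRate y' := by
    refine ⟨fun j => Measurable.ite measurableSet_Iio (hy.measurable j) measurable_const,
      fun j t => ?_, fun j t => ?_⟩ <;> simp only [hy'] <;> split_ifs
    exacts [hy.nonneg j t, wsetfRate_nonneg I, hy.le_one j t, wsetfRate_le_one I]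
  have hlt : ∀ j, ∀ s < T, y' j s = y j s := fun j s hs => if_pos hs
  have hTT (j : Fin n) : wsetfRate I y' j T = wsetfRate I y j T :=
    wsetfRate_congr I (fun k => elapsed_congr hT le_rfl (hlt k)) j
  have hge : ∀ s ≥ T, ∀ j, y' j s = wsetfRate I y' j T := fun s hs j => by
    rw [hTT]; exact if_neg hs.not_gt
  obtain ⟨T', hT', hsub⟩ := (mem_nhdsGT_iff_exists_Ioo_subset' (lt_add_one T)).1
    (hr.eventually_wsetfRate_eq (I := I) fun u hu => hge u (le_of_lt hu))
  refine ⟨T', hT', y', hr, fun j s hs => ?_⟩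
  rcases lt_trichotomy s T with h | rfl | h
  · exact (hy.of_rate_eq hr hlt).rule j s h
  · exact hge s le_rfl j
  · rw [hge s h.le, hsub ⟨h, hs⟩ j]

/-- Solutions up to the members of a sequence of times can be glued. -/
theorem exists_glue {T : ℕ → ℝ} {y : ℕ → Fin n → ℝ → ℝ} (hy : ∀ i, FollowsWSETF I (y i) (T i)) :
    ∃ y', IsRate y' ∧ ∀ i, FollowsWSETF I y' (T i) := by
  classical
  -- The second alternative makes the search succeed also at times that no `T i` exceeds; there the
  -- glued rate is 0.
  have hp (s : ℝ) : ∃ i, s < T i ∨ ∀ k, T k ≤ s := by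
    by_cases h : ∃ i, s < T i
    · exact h.imp fun _ => Or.inl
    · exact ⟨0, Or.inr (by simpa using h)⟩
  set y' : Fin n → ℝ → ℝ := fun j s =>
    (Iio (T (Nat.find (hp s)))).indicator (y (Nat.find (hp s)) j) s with hy'
  have heq (i : ℕ) (j : Fin n) (s : ℝ) (hs : s < T i) : y' j s = y i j s := by
    have hf : s < T (Nat.find (hp s)) := (Nat.find_spec (hp s)).resolve_right
      fun h => (h i).not_gt hs
    simp only [hy', indicator_of_mem (mem_Iio.2 hf)]
    exact ((hy _).mono (min_le_left _ _)).rate_unique ((hy i).mono (min_le_right _ _)) j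
      (lt_min hf hs)
  have hr : IsRate y' := by
    refine ⟨fun j => ?_, fun j t => indicator_nonneg (fun _ _ => (hy _).nonneg j _) t,
      fun j t => indicator_apply_le' (fun _ => (hy _).le_one j t) fun _ => zero_le_one⟩
    refine Measurable.find (f := fun i => (Iio (T i)).indicator (y i j))
      (fun i => ((hy i).measurable j).indicator measurableSet_Iio) (fun i => ?_) hp
    simp only [ofPred_or, ofPred_forall]
    exact measurableSet_Iio.union (MeasurableSet.iInter fun k => measurableSet_Ici)
  exact ⟨y', hr, fun i => (hy i).of_rate_eq hr (heq i)⟩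

/-- Otherwise the reachable horizons are bounded. Gluing reaches their supremum, and extension then
goes beyond it. -/
theorem exists_until (I : Instance n) (T : ℝ) : ∃ y, FollowsWSETF I y T := by
  by_contra hT
  set S : Set ℝ := {t | ∃ y, FollowsWSETF I y t} with hS
  have h0 : (0 : ℝ) ∈ S := ⟨_, zero I⟩
  have hbdd : BddAbove S := ⟨T, fun t ⟨y, hy⟩ => le_of_not_gt fun h => hT ⟨y, hy.mono h.le⟩⟩
  obtain ⟨u, -, hu, huS⟩ := exists_seq_tendsto_sSup ⟨0, h0⟩ hbdd
  choose y hy using huS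
  obtain ⟨y', hr, hy'⟩ := exists_glue hy
  have hsup : FollowsWSETF I y' (sSup S) := by
    refine ⟨hr, fun j s hs => ?_⟩
    obtain ⟨i, hi⟩ := (hu.eventually_const_lt hs).exists
    exact (hy' i).rule j s hi
  obtain ⟨T', hT', y'', hy''⟩ := hsup.exists_extend (le_csSup hbdd h0)
  exact hT'.not_ge (le_csSup hbdd ⟨y'', hy''⟩)

theorem exists_forall (I : Instance n) : ∃ y, ∀ T, FollowsWSETF I y T := by
  choose y hy using fun i : ℕ => exists_until I i
  obtain ⟨y', -, hy'⟩ := exists_glue hy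
  refine ⟨y', fun T => ?_⟩
  obtain ⟨i, hi⟩ := exists_nat_ge T
  exact (hy' i).mono hi

end FollowsWSETF

/-! ### Schedules -/

namespace Schedule

variable {I : Instance n} (X : Schedule I)

theorem isRate : IsRate X.rate where
  measurable := X.measurable_rate
  nonneg := X.rate_nonneg
  le_one j t := (Finset.single_le_sum (f := fun j => X.rate j t) (fun _ _ => X.rate_nonneg _ _)
    (Finset.mem_univ j)).trans (X.sum_rate_le_one t)

theorem completionTime_nonneg (j : Fin n) : 0 ≤ completionTime I X.rate j :=
  le_csInf (X.completes j) fun _ h => h.1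

theorem completionTime_le {j : Fin n} {t : ℝ} (ht : 0 ≤ t) (h : I.p j ≤ elapsed X.rate j t) :
    completionTime I X.rate j ≤ t :=
  csInf_le ⟨0, fun _ h => h.1⟩ ⟨ht, h⟩

theorem elapsed_le (j : Fin n) (t : ℝ) : elapsed X.rate j t ≤ I.p j := by
  by_contra! h
  have ht : 0 ≤ t := by
    by_contra! ht
    have := X.isRate.elapsed_mono j ht.le
    rw [elapsed_zero] at this
    linarith [I.p_pos j]
  obtain ⟨u, hu, hup⟩ := intermediate_value_Icc ht (X.isRate.continuous_elapsed j).continuousOn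
    ⟨(elapsed_zero X.rate j).trans_le (I.p_pos j).le, h.le⟩
  have := X.isRate.elapsed_eq_of_rate_eq_zero hu.2 fun v hv =>
    X.rate_after_completion j v ((X.completionTime_le hu.1 hup.ge).trans_lt hv.1)
  linarith

theorem elapsed_completionTime (j : Fin n) :
    elapsed X.rate j (completionTime I X.rate j) = I.p j := by
  refine le_antisymm (X.elapsed_le j _) ?_
  have hc : IsClosed {t : ℝ | 0 ≤ t ∧ I.p j ≤ elapsed X.rate j t} :=
    isClosed_Ici.inter (isClosed_le continuous_const (X.isRate.continuous_elapsed j))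
  exact (hc.csInf_mem (X.completes j) ⟨0, fun _ h => h.1⟩).2

theorem elapsed_of_completionTime_le {j : Fin n} {t : ℝ} (h : completionTime I X.rate j ≤ t) :
    elapsed X.rate j t = I.p j :=
  le_antisymm (X.elapsed_le j t) (X.elapsed_completionTime j ▸ X.isRate.elapsed_mono j h)

theorem elapsed_lt_of_lt_completionTime {j : Fin n} {t : ℝ} (ht : 0 ≤ t)
    (h : t < completionTime I X.rate j) : elapsed X.rate j t < I.p j :=
  lt_of_not_ge fun hp => h.not_ge (X.completionTime_le ht hp)

theorem elapsed_nonneg (j : Fin n) {t : ℝ} (ht : 0 ≤ t) : 0 ≤ elapsed X.rate j t :=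
  elapsed_zero X.rate j ▸ X.isRate.elapsed_mono j ht

theorem elapsed_of_le_release {j : Fin n} {t : ℝ} (ht : 0 ≤ t) (h : t ≤ I.r j) :
    elapsed X.rate j t = 0 := by
  rw [X.isRate.elapsed_eq_of_rate_eq_zero ht fun u hu =>
    X.rate_before_release j u (hu.2.trans_le h), elapsed_zero]

theorem release_le_completionTime (j : Fin n) : I.r j ≤ completionTime I X.rate j := by
  by_contra! h
  have := X.elapsed_of_le_release (X.completionTime_nonneg j) h.le
  rw [X.elapsed_completionTime] at this
  exact (I.p_pos j).ne' this

theorem cost_nonneg : 0 ≤ X.cost :=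
  Finset.sum_nonneg fun j _ => mul_nonneg (I.w_pos j).le (X.completionTime_nonneg j)

theorem opt_le_cost : opt I ≤ X.cost := ciInf_le ⟨0, by rintro _ ⟨X, rfl⟩; exact X.cost_nonneg⟩ X

theorem IsWSETF.follows {S : Schedule I} (hS : S.IsWSETF) (T : ℝ) : FollowsWSETF I S.rate T :=
  ⟨S.isRate, fun j s _ => hS j s⟩

theorem IsWSETF.unique {S S' : Schedule I} (hS : S.IsWSETF) (hS' : S'.IsWSETF) : S = S' := by
  ext j t
  exact (hS.follows (t + 1)).rate_unique (hS'.follows (t + 1)) j (lt_add_one t)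

theorem exists_isWSETF (I : Instance n) : ∃ S : Schedule I, S.IsWSETF := by
  obtain ⟨y, hy⟩ := FollowsWSETF.exists_forall I
  have hr : IsRate y := (hy 0).toIsRate
  have hrule (j : Fin n) (t : ℝ) : y j t = wsetfRate I y j t := (hy (t + 1)).rule j t (lt_add_one t)
  have hle (k : Fin n) {t : ℝ} (ht : 0 ≤ t) : elapsed y k t ≤ I.p k := by
    have := hr.min_elapsed_sub (j := k) (c := I.p k) ht fun u _ h => by
      rw [hrule, wsetfRate_of_completed I h]
    rw [elapsed_zero, min_eq_left (I.p_pos k).le] at this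
    linarith [min_le_right (elapsed y k t) (I.p k)]
  have hcompl (j : Fin n) : ∃ t : ℝ, 0 ≤ t ∧ I.p j ≤ elapsed y j t := by
    by_contra! h
    have hr0 := I.r_nonneg j
    have hsum0 : 0 ≤ ∑ k, I.p k := Finset.sum_nonneg fun k _ => (I.p_pos k).le
    -- If `j` never finished, the machine would be busy from its release until `b`, one unit longer
    -- than the total work.
    set b : ℝ := I.r j + ∑ k, I.p k + 1 with hb
    have hrb : I.r j ≤ b := by linarith
    have h1 := hr.sum_elapsed_sub_eq hrb fun t ht => by
      simp only [hrule]
      exact sum_wsetfRate I ⟨j, (mem_pending I).2 ⟨ht.1.le, h t (hr0.trans ht.1.le)⟩⟩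
    have h2 : ∑ k, (elapsed y k b - elapsed y k (I.r j)) ≤ ∑ k, I.p k :=
      Finset.sum_le_sum fun k _ => by
        have := hle k (hr0.trans hrb)
        have := hr.elapsed_mono k hr0
        rw [elapsed_zero] at this
        linarith
    linarith
  refine ⟨⟨y, hr.measurable, hr.nonneg, fun t => ?_, fun j t ht => ?_, fun j t ht => ?_, hcompl⟩,
    hrule⟩
  · simp only [hrule]
    exact sum_wsetfRate_le_one I
  · rw [hrule, wsetfRate_of_lt_release I ht]
  · obtain ⟨u, hu, hut⟩ := exists_lt_of_csInf_lt (hcompl j) ht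
    rw [hrule, wsetfRate_of_completed I (hu.2.trans (hr.elapsed_mono j hut.le))]

/-! ### Upper bound for WSETF -/

/-- If WSETF has a pending job at level less than `θ`, then it does not process jobs at level at
least `θ`. -/
theorem IsWSETF.rate_eq_zero {S : Schedule I} (hS : S.IsWSETF) {j k : Fin n} {t θ : ℝ}
    (hj : j ∈ pending I S.rate t) (hjθ : elapsed S.rate j t < I.w j * θ)
    (hk : I.w k * θ ≤ elapsed S.rate k t) : S.rate k t = 0 := by
  rw [hS]
  refine wsetfRate_of_level_lt I hj (lt_of_lt_of_le ?_ ((le_div_iff₀' (I.w_pos k)).2 hk))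
  exact (div_lt_iff₀' (I.w_pos j)).2 hjθ

/-- While WSETF has a pending job at level less than `θ`, the total elapsed time truncated at
level `θ` grows at full speed. -/
theorem IsWSETF.sum_min_elapsed_sub {S : Schedule I} (hS : S.IsWSETF) {a b θ : ℝ} (hab : a ≤ b)
    (h : ∀ t ∈ Ioo a b, ∃ j ∈ pending I S.rate t, elapsed S.rate j t < I.w j * θ) :
    ∑ k, min (elapsed S.rate k b) (I.w k * θ) - ∑ k, min (elapsed S.rate k a) (I.w k * θ)
      = b - a := by
  rw [← Finset.sum_sub_distrib, ← S.isRate.sum_elapsed_sub_eq hab fun t ht => ?_]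
  · refine Finset.sum_congr rfl fun k _ => S.isRate.min_elapsed_sub hab fun u hu huk => ?_
    obtain ⟨j, hj, hjθ⟩ := h u hu
    exact hS.rate_eq_zero hj hjθ huk
  · obtain ⟨j, hj, -⟩ := h t ht
    simp only [hS _ t]
    exact sum_wsetfRate I ⟨j, hj⟩

/-- Up to its completion `j` is below level `p j / w j`, so the time elapsed since its release
equals the growth of the truncated work. -/
theorem IsWSETF.completionTime_le {S : Schedule I} (hS : S.IsWSETF) (j : Fin n) :
    completionTime I S.rate j ≤ I.r j + ∑ k, min (I.p k) (I.w k * (I.p j / I.w j))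
      - ∑ k, min (elapsed S.rate k (I.r j)) (I.w k * (I.p j / I.w j)) := by
  have h := hS.sum_min_elapsed_sub (θ := I.p j / I.w j) (S.release_le_completionTime j)
    fun t ht => by
      have := S.elapsed_lt_of_lt_completionTime ((I.r_nonneg j).trans ht.1.le) ht.2
      refine ⟨j, (mem_pending I).2 ⟨ht.1.le, this⟩, ?_⟩
      rwa [mul_div_cancel₀ _ (I.w_pos j).ne']
  have h2 : ∑ k, min (elapsed S.rate k (completionTime I S.rate j)) (I.w k * (I.p j / I.w j)) ≤
      ∑ k, min (I.p k) (I.w k * (I.p j / I.w j)) :=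
    Finset.sum_le_sum fun k _ => min_le_min_right _ (S.elapsed_le k _)
  linarith

/-- No schedule processes more truncated work than WSETF. -/
theorem IsWSETF.sum_mul_min_le {S : Schedule I} (hS : S.IsWSETF) {θ t : ℝ} (hθ : 0 ≤ θ)
    (ht : 0 ≤ t) :
    ∑ k, elapsed X.rate k t * min 1 (I.w k * θ / I.p k)
      ≤ ∑ k, min (elapsed S.rate k t) (I.w k * θ) := by
  by_contra! hlt
  obtain ⟨s, h0s, hst, hs, hpos⟩ := exists_last_nonpos
    (f := fun t => ∑ k, elapsed X.rate k t * min 1 (I.w k * θ / I.p k) -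
      ∑ k, min (elapsed S.rate k t) (I.w k * θ))
    ((continuous_finsetSum _ fun k _ => (X.isRate.continuous_elapsed k).mul_const _).sub
      (continuous_finsetSum _ fun k _ => (S.isRate.continuous_elapsed k).min continuous_const))
    ht (by
      simp only [elapsed_zero, zero_mul, Finset.sum_const_zero, zero_sub, neg_nonpos]
      exact Finset.sum_nonneg fun k _ => le_min le_rfl (mul_nonneg (I.w_pos k).le hθ))
    (sub_pos.2 hlt)
  -- After the last time `s` at which `X` was not ahead, some pending job is always below `θ`:
  -- otherwise every released job would have its maximal truncated work and `X` could not be ahead.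
  -- So WSETF gains `t - s`, and `X` no more.
  have h1 := hS.sum_min_elapsed_sub hst.le (θ := θ) fun u hu => by
    by_contra! hnone
    refine (hpos u ⟨hu.1, hu.2.le⟩).not_ge (sub_nonpos.2 (Finset.sum_le_sum fun k _ => ?_))
    have hu0 : 0 ≤ u := h0s.trans hu.1.le
    have hw := mul_nonneg (I.w_pos k).le hθ
    rcases le_or_gt u (I.r k) with hr | hr
    · rw [X.elapsed_of_le_release hu0 hr, S.elapsed_of_le_release hu0 hr, zero_mul]
      exact le_min le_rfl hw
    · have hp := I.p_pos k
      have hX := X.elapsed_le k u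
      have hX0 := X.elapsed_nonneg k hu0
      have hXp : elapsed X.rate k u * min 1 (I.w k * θ / I.p k) ≤ I.w k * θ :=
        calc _ ≤ I.p k * (I.w k * θ / I.p k) := by gcongr; exact min_le_right _ _
          _ = _ := mul_div_cancel₀ _ hp.ne'
      refine le_min ?_ hXp
      rcases lt_or_ge (elapsed S.rate k u) (I.p k) with hY | hY
      · exact hXp.trans (hnone k ((mem_pending I).2 ⟨hr.le, hY⟩))
      · exact ((mul_le_of_le_one_right hX0 (min_le_left _ _)).trans hX).trans hY
  have h2 : ∑ k, elapsed X.rate k t * min 1 (I.w k * θ / I.p k) -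
      ∑ k, elapsed X.rate k s * min 1 (I.w k * θ / I.p k) ≤ t - s := by
    rw [← Finset.sum_sub_distrib]
    refine (Finset.sum_le_sum fun k _ => ?_).trans
      (X.isRate.sum_elapsed_sub_le X.sum_rate_le_one hst.le)
    rw [← sub_mul]
    exact mul_le_of_le_one_right (sub_nonneg.2 (X.isRate.elapsed_mono k hst.le)) (min_le_left _ _)
  linarith

end Schedule

/-! ### Lower bound on the cost of any schedule, and the factor 2 -/

namespace Schedule

variable {I : Instance n} (X : Schedule I)

/-- The rate of `j` has integral `p j` and vanishes outside the time between release and completion.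
There the weighted work, with weights at most 1, exceeds its value at the release by at most the
time since then. -/
theorem sum_integral_le (j : Fin n) {θ : ℝ} {T : ℝ} (hT : completionTime I X.rate j ≤ T) :
    ∑ k, min 1 (I.w k * θ / I.p k) * ∫ s in (0 : ℝ)..T, X.rate j s * elapsed X.rate k s
      ≤ (completionTime I X.rate j - I.r j
        + ∑ k, elapsed X.rate k (I.r j) * min 1 (I.w k * θ / I.p k)) * I.p j := by
  set C := completionTime I X.rate j with hC
  set m : Fin n → ℝ := fun k => min 1 (I.w k * θ / I.p k) with hm
  have hT0 : 0 ≤ T := (X.completionTime_nonneg j).trans hT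
  have hi (k : Fin n) : IntervalIntegrable (fun s => m k * (X.rate j s * elapsed X.rate k s))
      volume 0 T :=
    ((X.isRate.intervalIntegrable j 0 T).mul_continuousOn
      (X.isRate.continuous_elapsed k).continuousOn).const_mul _
  have hint : I.p j = ∫ s in (0 : ℝ)..T, X.rate j s :=
    (X.elapsed_of_completionTime_le hT).symm
  conv_rhs => rw [hint]
  simp only [← intervalIntegral.integral_const_mul]
  rw [← intervalIntegral.integral_finsetSum fun k _ => hi k]
  refine intervalIntegral.integral_mono_on hT0
    (by simpa only [Finset.sum_fn] using IntervalIntegrable.sum Finset.univ fun k _ => hi k)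
    ((X.isRate.intervalIntegrable j 0 T).const_mul _) fun s _ => ?_
  have hfac : ∑ k, m k * (X.rate j s * elapsed X.rate k s) =
      (∑ k, elapsed X.rate k s * m k) * X.rate j s := by
    rw [Finset.sum_mul]
    exact Finset.sum_congr rfl fun k _ => by ring
  rw [hfac]
  rcases lt_or_ge s (I.r j) with hr | hr
  · simp [X.rate_before_release j s hr]
  rcases lt_or_ge C s with hs | hs
  · simp [X.rate_after_completion j s hs]
  refine mul_le_mul_of_nonneg_right ?_ (X.rate_nonneg j s)
  have h2 : ∑ k, elapsed X.rate k s * m k - ∑ k, elapsed X.rate k (I.r j) * m k ≤ s - I.r j := by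
    rw [← Finset.sum_sub_distrib]
    refine (Finset.sum_le_sum fun k _ => ?_).trans
      (X.isRate.sum_elapsed_sub_le X.sum_rate_le_one hr)
    rw [← sub_mul]
    exact mul_le_of_le_one_right (sub_nonneg.2 (X.isRate.elapsed_mono k hr)) (min_le_left _ _)
  linarith

/-- A lower bound on the cost of any schedule, in terms of the amounts of work done until the
release dates. -/
theorem le_two_mul_cost :
    ∑ j, I.w j * ∑ k, min (I.p k) (I.w k * (I.p j / I.w j)) ≤
      2 * ∑ j, I.w j * (completionTime I X.rate j - I.r j
        + ∑ k, elapsed X.rate k (I.r j) * min 1 (I.w k * (I.p j / I.w j) / I.p k)) := by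
  set T : ℝ := ∑ j, completionTime I X.rate j with hTdef
  have hT (j : Fin n) : completionTime I X.rate j ≤ T :=
    Finset.single_le_sum (f := fun j => completionTime I X.rate j)
      (fun i _ => X.completionTime_nonneg i) (Finset.mem_univ j)
  set c : Fin n → Fin n → ℝ := fun j k => min (I.w j / I.p j) (I.w k / I.p k) with hc
  set F : Fin n → Fin n → ℝ :=
    fun j k => ∫ s in (0 : ℝ)..T, X.rate j s * elapsed X.rate k s with hF
  have hFF (j k : Fin n) : F j k + F k j = I.p j * I.p k := by
    rw [hF, X.isRate.integral_rate_mul_elapsed j k T, X.elapsed_of_completionTime_le (hT j),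
      X.elapsed_of_completionTime_le (hT k)]
  have hcm (j k : Fin n) : I.w j / I.p j * min 1 (I.w k * (I.p j / I.w j) / I.p k) = c j k := by
    have h1 := I.w_pos j
    have h2 := I.p_pos j
    have h3 := I.p_pos k
    rw [mul_min_of_nonneg _ _ (div_pos h1 h2).le, mul_one]
    congr 1
    field_simp
  have hcp (j k : Fin n) : I.w j * min (I.p k) (I.w k * (I.p j / I.w j)) =
      c j k * (I.p j * I.p k) := by
    have h1 := I.w_pos j
    have h2 := I.p_pos j
    have h3 := I.p_pos k
    rw [mul_min_of_nonneg _ _ h1.le, min_mul_of_nonneg _ _ (mul_pos h2 h3).le]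
    congr 1 <;> field_simp
  have hj (j : Fin n) : ∑ k, c j k * F j k ≤ I.w j * (completionTime I X.rate j - I.r j
        + ∑ k, elapsed X.rate k (I.r j) * min 1 (I.w k * (I.p j / I.w j) / I.p k)) := by
    have h1 := I.w_pos j
    have h2 := I.p_pos j
    have h := mul_le_mul_of_nonneg_left (X.sum_integral_le j (θ := I.p j / I.w j) (hT j))
      (div_pos h1 h2).le
    rw [Finset.mul_sum] at h
    simp only [← mul_assoc, hcm] at h
    refine h.trans (le_of_eq ?_)
    field_simp
  -- Integration by parts splits `p j * p k`, and the symmetry of `c` makes the two halves equal.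
  calc ∑ j, I.w j * ∑ k, min (I.p k) (I.w k * (I.p j / I.w j))
      = ∑ j, ∑ k, c j k * (F j k + F k j) := by simp only [Finset.mul_sum, hcp, hFF]
    _ = ∑ j, ∑ k, c j k * F j k + ∑ j, ∑ k, c j k * F k j := by
      simp only [mul_add, Finset.sum_add_distrib]
    _ = ∑ j, ∑ k, c j k * F j k + ∑ j, ∑ k, c j k * F j k := by
      congr 1
      rw [Finset.sum_comm]
      simp only [hc, min_comm]
    _ = 2 * ∑ j, ∑ k, c j k * F j k := by ring
    _ ≤ _ := by gcongr with j; exact hj j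

theorem IsWSETF.cost_le {S : Schedule I} (hS : S.IsWSETF) : S.cost ≤ 2 * X.cost := by
  have hX := X.le_two_mul_cost
  set a : Fin n → ℝ := fun j =>
    ∑ k, elapsed X.rate k (I.r j) * min 1 (I.w k * (I.p j / I.w j) / I.p k) with ha
  set q : Fin n → ℝ := fun j => ∑ k, min (I.p k) (I.w k * (I.p j / I.w j)) with hq
  -- The nonnegative slack `r j - a j` is added once more, to match the doubled lower bound for `X`.
  have hSj (j : Fin n) : completionTime I S.rate j ≤ 2 * I.r j - 2 * a j + q j := by
    have h1 := hS.completionTime_le j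
    have h2 := IsWSETF.sum_mul_min_le X hS (div_pos (I.p_pos j) (I.w_pos j)).le (I.r_nonneg j)
    have h3 : a j ≤ I.r j := by
      have h4 := X.isRate.sum_elapsed_sub_le X.sum_rate_le_one (I.r_nonneg j)
      simp only [elapsed_zero, sub_zero] at h4
      exact (Finset.sum_le_sum fun k _ => mul_le_of_le_one_right
        (X.elapsed_nonneg k (I.r_nonneg j)) (min_le_left _ _)).trans h4
    simp only [ha, hq] at *
    linarith
  have h1 : S.cost ≤ ∑ j, I.w j * (2 * I.r j - 2 * a j + q j) :=
    Finset.sum_le_sum fun j _ => mul_le_mul_of_nonneg_left (hSj j) (I.w_pos j).le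
  have h2 : ∑ j, I.w j * (2 * I.r j - 2 * a j + q j) + 2 * ∑ j, I.w j *
      (completionTime I X.rate j - I.r j + a j) = ∑ j, I.w j * q j + 2 * X.cost := by
    simp only [cost, Finset.mul_sum, ← Finset.sum_add_distrib]
    exact Finset.sum_congr rfl fun j _ => by ring
  linarith

theorem IsWSETF.cost_le_two_mul_opt {S : Schedule I} (hS : S.IsWSETF) : S.cost ≤ 2 * opt I := by
  have : Nonempty (Schedule I) := ⟨S⟩
  have h : S.cost / 2 ≤ opt I := le_ciInf fun X => by linarith [IsWSETF.cost_le X hS]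
  linarith

end Schedule

/-! ### Non-clairvoyance of WSETF -/

theorem Strategy.IsWSETF.isOnlineNonClairvoyant {A : Strategy} (hA : A.IsWSETF) :
    A.IsOnlineNonClairvoyant := by
  intro n m h I I' t hI hI' j s hst
  set y := (A n I).rate with hy
  have hyr : IsRate y := (A n I).isRate
  have hrule : ∀ j s, y j s = wsetfRate I y j s := hA n I
  set f : Fin n ↪ Fin m := Fin.castLEEmb h with hf
  -- The run on `I`, with the further jobs idle, obeys the rule on `I'` up to time `t`; uniqueness
  -- identifies it with the run on `I'`.
  set z : Fin m → ℝ → ℝ := fun i s => if hi : (i : ℕ) < n then y ⟨i, hi⟩ s else 0 with hz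
  have hzf (j : Fin n) (s : ℝ) : z (f j) s = y j s := by simp [hz, hf]
  have hzr : IsRate z := by
    refine ⟨fun i => ?_, fun i s => ?_, fun i s => ?_⟩ <;> by_cases hi : (i : ℕ) < n <;>
      simp only [hz, hi, dite_true, dite_false]
    exacts [hyr.measurable _, measurable_const, hyr.nonneg _ _, le_rfl, hyr.le_one _ _, zero_le_one]
  have hel (j : Fin n) (s : ℝ) : elapsed z (f j) s = elapsed y j s := by
    simp only [elapsed, hzf]
  have hcases (i : Fin m) : (∃ j, f j = i) ∨ n ≤ (i : ℕ) := by
    rcases lt_or_ge (i : ℕ) n with hi | hi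
    · exact Or.inl ⟨⟨i, hi⟩, rfl⟩
    · exact Or.inr hi
  have hzrule (i : Fin m) (s : ℝ) (hst : s ≤ t) : z i s = wsetfRate I' z i s := by
    have hw : ∀ j ∈ pending I y s, I.w j = I'.w (f j) := fun j hj =>
      ((hI j).resolve_left fun hr => (((mem_pending I).1 hj).1.trans hst).not_gt hr.1).2.1
    have hp : pending I' z s = (pending I y s).map f := by
      ext i
      rcases hcases i with ⟨j, rfl⟩ | hi
      · rw [Finset.mem_map', mem_pending, mem_pending, hel]
        rcases hI j with hr | ⟨hr, -, hpp⟩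
        · exact iff_of_false (fun h => (h.1.trans hst).not_gt hr.2)
            fun h => (h.1.trans hst).not_gt hr.1
        · change _ = I'.r (f j) at hr
          rw [hr]
          rcases hpp with hpp | hpp
          · change _ = I'.p (f j) at hpp
            rw [hpp]
          · have := hyr.elapsed_mono j hst
            exact and_congr_right fun _ => iff_of_true (this.trans_lt hpp.2) (this.trans_lt hpp.1)
      · refine iff_of_false (fun h => (((mem_pending I').1 h).1.trans hst).not_gt (hI' i hi)) ?_
        rw [Finset.mem_map]
        rintro ⟨j, -, rfl⟩
        exact hi.not_gt j.2
    have ha := active_congr I f hp fun j hj => by rw [hel, hw j hj]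
    have hsub : active I y s ⊆ pending I y s := fun j hj => ((mem_active I).1 hj).1
    rcases hcases i with ⟨j, rfl⟩ | hi
    · rw [hzf, hrule]
      by_cases hj : j ∈ active I y s
      · rw [wsetfRate_of_mem I hj, wsetfRate_of_mem I' (ha ▸ Finset.mem_map_of_mem f hj), ha,
          Finset.sum_map, hw j (hsub hj)]
        congr 1
        exact Finset.sum_congr rfl fun k hk => hw k (hsub hk)
      · rw [wsetfRate_eq_zero I hj, wsetfRate_eq_zero I']
        rwa [ha, Finset.mem_map']
    · rw [wsetfRate_of_lt_release I' (hst.trans_lt (hI' i hi))]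
      simp [hz, hi.not_gt]
  change y j s = (A m I').rate (f j) s
  rw [← hzf, hzrule _ _ hst, hA m I']
  rcases lt_or_ge s 0 with h0 | h0
  · rw [wsetfRate_of_lt_release I' (h0.trans_le (I'.r_nonneg _)),
      wsetfRate_of_lt_release I' (h0.trans_le (I'.r_nonneg _))]
  · have hz' : FollowsWSETF I' z t := ⟨hzr, fun i u hu => hzrule i u hu.le⟩
    exact wsetfRate_congr I'
      (fun k => hz'.elapsed_unique (Schedule.IsWSETF.follows (hA m I') t) h0 hst k) _

/-! ### Lower bound for non-clairvoyant strategies -/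

section LowerBound

variable {I : Instance n}

/-- Jobs can be processed at full speed in disjoint time intervals after their release. -/
theorem exists_schedule_of_start (s : Fin n → ℝ) (hs : ∀ j, I.r j ≤ s j)
    (hd : ∀ j k, j ≠ k → Disjoint (Ico (s j) (s j + I.p j)) (Ico (s k) (s k + I.p k))) :
    ∃ X : Schedule I, ∀ j, completionTime I X.rate j ≤ s j + I.p j := by
  set y : Fin n → ℝ → ℝ := fun j => (Ico (s j) (s j + I.p j)).indicator 1 with hy
  have hr : IsRate y := by
    refine ⟨fun j => measurable_one.indicator measurableSet_Ico,
      fun j => indicator_nonneg fun _ _ => zero_le_one,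
      fun j t => indicator_apply_le' (fun _ => le_rfl) fun _ => zero_le_one⟩
  have hs0 (j : Fin n) : 0 ≤ s j := (I.r_nonneg j).trans (hs j)
  have h1 (j : Fin n) : elapsed y j (s j) = 0 := by
    rw [hr.elapsed_eq_of_rate_eq_zero (hs0 j) fun u hu =>
      indicator_of_notMem (fun h => h.1.not_gt hu.2) _, elapsed_zero]
  have h2 (j : Fin n) (t : ℝ) (ht : s j ≤ t) (ht' : t ≤ s j + I.p j) :
      elapsed y j t = t - s j := by
    rw [hr.elapsed_sub_eq_mul (c := 1) ht fun u hu =>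
      indicator_of_mem (mem_Ico.2 ⟨hu.1.le, hu.2.trans_le ht'⟩) _, h1]
    simp
  have hp (j : Fin n) : s j ≤ s j + I.p j := le_add_of_nonneg_right (I.p_pos j).le
  have h3 (j : Fin n) : 0 ≤ s j + I.p j ∧ I.p j ≤ elapsed y j (s j + I.p j) :=
    ⟨(hs0 j).trans (hp j), by rw [h2 j _ (hp j) le_rfl]; simp⟩
  have hC (j : Fin n) : s j + I.p j ≤ completionTime I y j := by
    refine le_csInf ⟨_, h3 j⟩ fun t ht => ?_
    by_contra! hlt
    rcases le_or_gt t (s j) with hts | hts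
    · have := hr.elapsed_mono j hts
      rw [h1] at this
      linarith [ht.2, I.p_pos j]
    · have := h2 j t hts.le hlt.le
      linarith [ht.2]
  refine ⟨⟨y, hr.measurable, hr.nonneg, fun t => ?_, fun j t ht => ?_, fun j t ht => ?_,
    fun j => ⟨_, h3 j⟩⟩, fun j => csInf_le ⟨0, fun _ h => h.1⟩ (h3 j)⟩
  · by_cases h : ∃ j, t ∈ Ico (s j) (s j + I.p j)
    · obtain ⟨j, hj⟩ := h
      rw [Finset.sum_eq_single j (fun k _ hkj => indicator_of_notMem
        (fun hk => disjoint_left.1 (hd k j hkj) hk hj) _) (by simp)]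
      exact hr.le_one j t
    · push Not at h
      rw [Finset.sum_eq_zero fun j _ => indicator_of_notMem (h j) _]
      exact zero_le_one
  · exact indicator_of_notMem (fun h => h.1.not_gt (ht.trans_le (hs j))) _
  · exact indicator_of_notMem (fun h => h.2.not_gt ((hC j).trans_lt ht)) _

/-- Schedule the jobs by index and in reverse: the two completion times of `j` add up to `∑ k, p k +
p j`. The optimum is at most the average of both costs. -/
theorem Instance.IsUnitTrivial.opt_le (hI : I.IsUnitTrivial) :
    2 * opt I ≤ (n + 1) * ∑ j, I.p j := by
  have hp0 (j : Fin n) : 0 ≤ I.p j := (I.p_pos j).le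
  have hdisj {s : Fin n → ℝ} (r : Fin n → Fin n → Prop) (hr : ∀ j k, j ≠ k → r j k ∨ r k j)
      (h : ∀ j k, r j k → s j + I.p j ≤ s k) (j k : Fin n) (hjk : j ≠ k) :
      Disjoint (Ico (s j) (s j + I.p j)) (Ico (s k) (s k + I.p k)) := by
    rw [disjoint_left]
    rintro t ⟨h1, h2⟩ ⟨h3, h4⟩
    rcases hr j k hjk with h' | h'
    · linarith [h j k h']
    · linarith [h k j h']
  have hcost {s : Fin n → ℝ} {X : Schedule I}
      (hX : ∀ j, completionTime I X.rate j ≤ s j + I.p j) : opt I ≤ ∑ j, (s j + I.p j) := by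
    refine X.opt_le_cost.trans (Finset.sum_le_sum fun j _ => ?_)
    rw [hI.1, one_mul]
    exact hX j
  obtain ⟨X, hX⟩ := exists_schedule_of_start (I := I) (fun j => ∑ k ∈ Finset.Iio j, I.p k)
    (fun j => by rw [hI.2]; exact Finset.sum_nonneg fun k _ => hp0 k)
    (hdisj (· < ·) (fun j k h => h.lt_or_gt) fun j k h => by
      rw [add_comm, ← Finset.sum_insert (by simp)]
      refine Finset.sum_le_sum_of_subset_of_nonneg (fun i hi => ?_) fun i _ _ => hp0 i
      simp only [Finset.mem_insert, Finset.mem_Iio] at hi ⊢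
      rcases hi with rfl | hi
      exacts [h, hi.trans h])
  obtain ⟨X', hX'⟩ := exists_schedule_of_start (I := I) (fun j => ∑ k ∈ Finset.Ioi j, I.p k)
    (fun j => by rw [hI.2]; exact Finset.sum_nonneg fun k _ => hp0 k)
    (hdisj (· > ·) (fun j k h => h.lt_or_gt.symm) fun j k h => by
      rw [add_comm, ← Finset.sum_insert (by simp)]
      refine Finset.sum_le_sum_of_subset_of_nonneg (fun i hi => ?_) fun i _ _ => hp0 i
      simp only [Finset.mem_insert, Finset.mem_Ioi] at hi ⊢
      rcases hi with rfl | hi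
      exacts [h, h.trans hi])
  have hsum (j : Fin n) : (∑ k ∈ Finset.Iio j, I.p k + I.p j) + (∑ k ∈ Finset.Ioi j, I.p k + I.p j)
      = ∑ k, I.p k + I.p j := by
    have h1 : ∑ k ∈ Finset.Iio j, I.p k + I.p j = ∑ k ∈ Finset.Iic j, I.p k := by
      rw [add_comm, ← Finset.sum_insert (by simp), Finset.Iio_insert]
    have h2 : ∑ k ∈ Finset.Iic j, I.p k + ∑ k ∈ Finset.Ioi j, I.p k = ∑ k, I.p k := by
      rw [← Finset.sum_union]
      · congr 1
        ext k
        simpa using le_or_gt k j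
      · rw [Finset.disjoint_left]
        intro k hk
        simpa using hk
    linarith
  have h := add_le_add (hcost hX) (hcost hX')
  rw [← Finset.sum_add_distrib] at h
  simp only [hsum, Finset.sum_add_distrib, Finset.sum_const, Finset.card_univ, Fintype.card_fin,
    nsmul_eq_mul] at h
  linarith

/-- The instance with unit weights and trivial release dates. -/
def unitInstance (p : Fin n → ℝ) (hp : ∀ j, 0 < p j) : Instance n where
  p := p
  w _ := 1
  r _ := 0
  p_pos := hp
  w_pos _ := one_pos
  r_nonneg _ := le_rfl

theorem unitInstance_isUnitTrivial (p : Fin n → ℝ) (hp : ∀ j, 0 < p j) :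
    (unitInstance p hp).IsUnitTrivial := ⟨fun _ => rfl, fun _ => rfl⟩

theorem Strategy.IsOnlineNonClairvoyant.exists_bad_instance {B : Strategy}
    (hB : B.IsOnlineNonClairvoyant) (n : ℕ) {ε : ℝ} (hε : 0 < ε) :
    ∃ I : Instance n, I.IsUnitTrivial ∧ n ≤ (B n I).cost ∧ ∑ j, I.p j ≤ 1 + n * ε := by
  -- Length 2 is more than any job can receive by time 1.
  set J : Instance n := unitInstance (fun _ => 2) (fun _ => two_pos) with hJ
  set e : Fin n → ℝ := fun j => elapsed (B n J).rate j 1 with he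
  have hsum : ∑ j, e j ≤ 1 := by
    simpa [elapsed_zero] using
      (B n J).isRate.sum_elapsed_sub_le (B n J).sum_rate_le_one zero_le_one
  have he0 (j : Fin n) : 0 ≤ e j := (B n J).elapsed_nonneg j zero_le_one
  have he1 (j : Fin n) : e j ≤ 1 :=
    (Finset.single_le_sum (fun i _ => he0 i) (Finset.mem_univ j)).trans hsum
  -- The extra `ε` leaves every job unfinished at time 1, so the strategy behaves on `I` as on `J`
  -- until then.
  set I : Instance n := unitInstance (fun j => e j + ε) (fun j => add_pos_of_nonneg_of_pos (he0 j) hε)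
    with hI
  have hrate := hB n n le_rfl J I 1
    (fun j => Or.inr ⟨rfl, rfl, Or.inr ⟨(he1 j).trans_lt one_lt_two, lt_add_of_pos_right _ hε⟩⟩)
    (fun i hi => absurd i.2 hi.not_gt)
  have hC (j : Fin n) : 1 ≤ completionTime I (B n I).rate j := by
    by_contra! hlt
    have h1 := (B n I).elapsed_of_completionTime_le hlt.le
    have h2 : elapsed (B n J).rate j 1 = elapsed (B n I).rate j 1 :=
      elapsed_congr zero_le_one le_rfl fun s hs => hrate j s hs.le
    have h3 : I.p j = e j + ε := rfl
    simp only [he] at h3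
    linarith
  refine ⟨I, unitInstance_isUnitTrivial _ _, ?_, ?_⟩
  · calc (n : ℝ) = ∑ _j : Fin n, (1 : ℝ) := by simp
      _ ≤ (B n I).cost := Finset.sum_le_sum fun j _ => by
        rw [show I.w j = 1 from rfl, one_mul]
        exact hC j
  · have : ∑ j, I.p j = ∑ j, e j + n * ε := by
      change ∑ j, (e j + ε) = _
      simp [Finset.sum_add_distrib]
    linarith

theorem Strategy.IsOnlineNonClairvoyant.two_le {B : Strategy} (hB : B.IsOnlineNonClairvoyant)
    {c : ℝ} (hc : B.IsCompetitiveOn (fun _ I => I.IsUnitTrivial) c) : 2 ≤ c := by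
  have key (n : ℕ) (hn : 0 < n) : 2 * (n : ℝ) ^ 2 ≤ c * (n + 1) ^ 2 := by
    have hn' : (0 : ℝ) < n := Nat.cast_pos.2 hn
    -- With this `ε` the total work is at most `1 + 1/n`, so twice the optimum is at most
    -- `(n+1)²/n`.
    obtain ⟨I, hI, hcost, hsum⟩ := hB.exists_bad_instance n (ε := 1 / (n : ℝ) ^ 2) (by positivity)
    have h1 := hcost.trans (hc n I hI)
    have h2 := hI.opt_le
    have h3 : (0 : ℝ) ≤ opt I :=
      Real.iInf_nonneg fun X => X.cost_nonneg
    have hc0 : 0 < c := by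
      by_contra! hc0
      have := mul_nonpos_of_nonpos_of_nonneg hc0 h3
      linarith
    have h4 : 2 * opt I ≤ (n + 1) * (1 + n * (1 / (n : ℝ) ^ 2)) :=
      h2.trans (mul_le_mul_of_nonneg_left hsum (by positivity))
    have h5 : (n + 1) * (1 + n * (1 / (n : ℝ) ^ 2)) * n = (n + 1 : ℝ) ^ 2 := by
      field_simp
    calc 2 * (n : ℝ) ^ 2 = 2 * n * n := by ring
      _ ≤ 2 * (c * opt I) * n := by gcongr
      _ = c * (2 * opt I) * n := by ring
      _ ≤ c * ((n + 1) * (1 + n * (1 / (n : ℝ) ^ 2))) * n := by gcongr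
      _ = c * (n + 1) ^ 2 := by rw [mul_assoc, h5]
  have hlim : Tendsto (fun n : ℕ => c * (1 + 1 / (n : ℝ)) ^ 2) atTop (𝓝 (c * (1 + 0) ^ 2)) :=
    ((tendsto_one_div_atTop_nhds_zero_nat.const_add 1).pow 2).const_mul c
  have h := ge_of_tendsto hlim (b := 2) (by
    filter_upwards [eventually_gt_atTop 0] with n hn
    have hn' : (0 : ℝ) < n := Nat.cast_pos.2 hn
    have := key n hn
    rw [one_add_div hn'.ne', div_pow, ← mul_div_assoc, le_div_iff₀ (by positivity)]
    exact this)
  simpa using h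

end LowerBound

end Scheduling

theorem mainTheorem6 :
    (∃! A : Scheduling.Strategy, A.IsWSETF) ∧
    (∀ A : Scheduling.Strategy, A.IsWSETF →
      A.IsOnlineNonClairvoyant ∧ A.IsCompetitive 2) ∧
    (∀ B : Scheduling.Strategy, B.IsOnlineNonClairvoyant →
      ∀ c : ℝ, B.IsCompetitiveOn (fun _ I => I.IsUnitTrivial) c → 2 ≤ c) := by
  refine ⟨?_, fun A hA => ⟨hA.isOnlineNonClairvoyant, fun n I _ => (hA n I).cost_le_two_mul_opt⟩,
    fun B hB c hc => hB.two_le hc⟩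
  choose A hA using fun n (I : Scheduling.Instance n) => Scheduling.Schedule.exists_isWSETF I
  exact ⟨A, hA, fun A' hA' => funext fun n => funext fun I => (hA' n I).unique (hA n I)⟩
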